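/- Let $G=(VG,EG,o,t)$ be a directed graph (multiple edges and loops allowed) in which every vertex is the origin of only finitely many edges, and let $R\in VG$ be a root, i.e. every vertex is reachable from $R$ by a directed walk. The unfolding tree $\mathcal T(G,R)$ has as vertices the finite (possibly empty) directed walks starting at $R$, ordered by the prefix relation, with an edge from $p$ to $pe$ whenever $pe$ extends $p$ by one edge $e$. A *cofinite subspace* is a set of vertices of $\mathcal T(G,R)$ with finite complement that is closed under extending walks; its *basis* is the set of its prefix-minimal elements. A *Higman–Thompson representative* is an isomorphism $\phi:\mathcal S\to\mathcal S'$ between cofinite subspaces (with the structure of directed forests induced from the tree) such that $\phi(bp)=\phi(b)p$ for every $b$ in the basis of $\mathcal S$ and every walk $p$ starting at the terminal vertex of $b$. Two representatives are equivalent if they have the same restriction to some cofinite subspace. The Higman–Thompson group $\mathcal{HT}(\mathcal T(G,R))$ is the group of equivalence classes of Higman–Thompson representatives under composition (on a cofinite subspace where the composite is defined). Let $v\neq w$ be vertices of $G$ and let $\theta:o^{-1}(w)\to o^{-1}(v)$ be an injection with $t(\theta(e))=t(e)$ for all $e\in o^{-1}(w)$. Let $G(w\hookrightarrow v)$ be the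 graph with vertex set $VG$ and edge set $\bigl(EG\setminus\theta(o^{-1}(w))\bigr)\cup\{f_{v,w}\}$, where $f_{v,w}$ is one new edge with origin $v$ and terminus $w$, and the other edges keep their origin and terminus. Then $$\mathcal{HT}(\mathcal T(G,R))\;\cong\;\mathcal{HT}(\mathcal T(G(w\hookrightarrow v),R)).$$ -/

import Mathlib

universe u₁ u₂

/-- A directed graph with multiple edges allowed: a vertex set `V`, an edge set `E`, and the
origin and terminus functions `o, t : E → V`. -/
structure MultiDigraph (V : Type u₁) (E : Type u₂) where
  /-- origin of an edge -/
  o : E → V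
  /-- terminus of an edge -/
  t : E → V

namespace MultiDigraph

variable {V : Type u₁} {E : Type u₂}

/-- The edge list `p` is a (possibly empty) directed walk originating in the given vertex. -/
def IsWalkFrom (G : MultiDigraph V E) : V → List E → Prop
  | _, [] => True
  | u, e :: p => G.o e = u ∧ G.IsWalkFrom (G.t e) p

/-- The terminal vertex of a walk originating in the given vertex. -/
def terminus (G : MultiDigraph V E) : V → List E → V
  | u, [] => u
  | _, e :: p => G.terminus (G.t e) p

/-- `R` is a root: every vertex (hence also every edge) can be reached by a directed walk
from `R`. -/
def IsRoot (G : MultiDigraph V E) (R : V) : Prop :=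
  ∀ u : V, ∃ p : List E, G.IsWalkFrom R p ∧ G.terminus R p = u

/-- Every vertex is the origin of only finitely many edges. -/
def RowFinite (G : MultiDigraph V E) : Prop :=
  ∀ u : V, {e : E | G.o e = u}.Finite

/-- The vertex set of the unfolding tree of `G` based on `R`: all walks originating in `R`.
The tree has an edge from `p` to `pe` for every walk `pe` extending `p` by one edge `e`. -/
@[ext]
structure UnfoldingTree (G : MultiDigraph V E) (R : V) : Type u₂ where
  /-- the list of edges of the walk -/
  walk : List E
  isWalk : G.IsWalkFrom R walk

namespace UnfoldingTree

variable {G : MultiDigraph V E} {R : V}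

/-- The prefix order. -/
instance : PartialOrder (UnfoldingTree G R) where
  le p q := p.walk <+: q.walk
  le_refl p := List.prefix_refl p.walk
  le_trans _ _ _ h₁ h₂ := List.IsPrefix.trans h₁ h₂
  le_antisymm _ _ h₁ h₂ :=
    UnfoldingTree.ext (h₁.eq_of_length (le_antisymm h₁.length_le h₂.length_le))

theorem le_iff {p q : UnfoldingTree G R} : p ≤ q ↔ ∃ r, p.walk ++ r = q.walk := Iff.rfl

/-- Cofinite subspaces: sets of vertices of the tree with finite complement that are closed
under passing to extensions. -/
def IsCofiniteSubspace (S : Set (UnfoldingTree G R)) : Prop :=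
  Sᶜ.Finite ∧ ∀ p ∈ S, ∀ q, p ≤ q → q ∈ S

/-- The basis of a cofinite subspace: its prefix-minimal elements. -/
def basis (S : Set (UnfoldingTree G R)) : Set (UnfoldingTree G R) :=
  {b | Minimal (· ∈ S) b}

theorem exists_basis_le {S : Set (UnfoldingTree G R)} {p : UnfoldingTree G R} (hp : p ∈ S) :
    ∃ b ∈ basis S, b ≤ p := by
  induction hn : p.walk.length using Nat.strong_induction_on generalizing p with
  | _ n ih =>
    by_cases h : ∃ q ∈ S, q ≤ p ∧ q ≠ p
    · obtain ⟨q, hq, hqp, hne⟩ := h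
      have hl : q.walk.length < n := by
        rw [← hn]
        refine lt_of_le_of_ne (List.IsPrefix.length_le hqp) fun he => hne ?_
        exact UnfoldingTree.ext (List.IsPrefix.eq_of_length hqp he)
      obtain ⟨b, hb, hbq⟩ := ih _ hl hq rfl
      exact ⟨b, hb, hbq.trans hqp⟩
    · push Not at h
      exact ⟨p, ⟨hp, fun q hq hqp => (h q hq hqp).ge⟩, le_rfl⟩

theorem IsCofiniteSubspace.univ : IsCofiniteSubspace (Set.univ : Set (UnfoldingTree G R)) :=
  ⟨by simp, fun _ _ _ _ => trivial⟩

theorem IsCofiniteSubspace.inter {S S' : Set (UnfoldingTree G R)}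
    (h : IsCofiniteSubspace S) (h' : IsCofiniteSubspace S') : IsCofiniteSubspace (S ∩ S') :=
  ⟨by rw [Set.compl_inter]; exact h.1.union h'.1,
    fun p hp q hpq => ⟨h.2 p hp.1 q hpq, h'.2 p hp.2 q hpq⟩⟩

end UnfoldingTree

open UnfoldingTree

/-- An almost automorphism representative of the unfolding tree: an isomorphism between two
cofinite subspaces, its domain `source` and its range `target`. On sets closed under extension,
the isomorphisms of the induced directed forests are exactly the isomorphisms for the prefix
order. (The values of the underlying functions outside `source` and `target` carry no
information; they are forgotten by the equivalence of representatives.) -/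
structure AlmostAutRep (G : MultiDigraph V E) (R : V) extends
    PartialEquiv (UnfoldingTree G R) (UnfoldingTree G R) where
  source_cofinite : IsCofiniteSubspace source
  target_cofinite : IsCofiniteSubspace target
  map_le_map_iff' : ∀ p ∈ source, ∀ q ∈ source, toFun p ≤ toFun q ↔ p ≤ q

namespace AlmostAutRep

variable {G : MultiDigraph V E} {R : V}

theorem map_le_map_iff (φ : AlmostAutRep G R) {p q : UnfoldingTree G R} (hp : p ∈ φ.source)
    (hq : q ∈ φ.source) : φ.toPartialEquiv p ≤ φ.toPartialEquiv q ↔ p ≤ q :=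
  φ.map_le_map_iff' p hp q hq

theorem preimage_cofinite (φ : AlmostAutRep G R) {S : Set (UnfoldingTree G R)}
    (hS : IsCofiniteSubspace S) :
    IsCofiniteSubspace (φ.source ∩ φ.toPartialEquiv ⁻¹' S) := by
  refine ⟨?_, ?_⟩
  · have h1 : (φ.source ∩ φ.toPartialEquiv ⁻¹' Sᶜ).Finite := by
      refine Set.Finite.of_finite_image (f := φ.toPartialEquiv) (hS.1.subset ?_)
        (φ.toPartialEquiv.injOn.mono Set.inter_subset_left)
      rintro _ ⟨x, hx, rfl⟩
      exact hx.2
    refine (φ.source_cofinite.1.union h1).subset fun x hx => ?_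
    by_cases hs : x ∈ φ.source
    · exact Or.inr ⟨hs, fun h => hx ⟨hs, h⟩⟩
    · exact Or.inl hs
  · rintro p ⟨hp, hpS⟩ q hpq
    have hq := φ.source_cofinite.2 p hp q hpq
    exact ⟨hq, hS.2 _ hpS _ ((φ.map_le_map_iff hp hq).2 hpq)⟩

/-- The identity on the whole tree. -/
def refl (G : MultiDigraph V E) (R : V) : AlmostAutRep G R where
  toPartialEquiv := PartialEquiv.refl _
  source_cofinite := IsCofiniteSubspace.univ
  target_cofinite := IsCofiniteSubspace.univ
  map_le_map_iff' _ _ _ _ := Iff.rfl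

/-- The inverse isomorphism. -/
def symm (φ : AlmostAutRep G R) : AlmostAutRep G R where
  toPartialEquiv := φ.toPartialEquiv.symm
  source_cofinite := φ.target_cofinite
  target_cofinite := φ.source_cofinite
  map_le_map_iff' p hp q hq := by
    have h := φ.map_le_map_iff (φ.toPartialEquiv.map_target hp) (φ.toPartialEquiv.map_target hq)
    rw [φ.toPartialEquiv.right_inv hp, φ.toPartialEquiv.right_inv hq] at h
    exact h.symm

/-- The composition `φ ∘ ψ`, restricted to the cofinite subspace on which it is defined. -/
def comp (φ ψ : AlmostAutRep G R) : AlmostAutRep G R where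
  toPartialEquiv := ψ.toPartialEquiv.trans φ.toPartialEquiv
  source_cofinite := by
    rw [PartialEquiv.trans_source]
    exact ψ.preimage_cofinite φ.source_cofinite
  target_cofinite := by
    rw [PartialEquiv.trans_target]
    exact φ.symm.preimage_cofinite ψ.target_cofinite
  map_le_map_iff' p hp q hq := by
    rw [PartialEquiv.trans_source] at hp hq
    exact (φ.map_le_map_iff hp.2 hq.2).trans (ψ.map_le_map_iff hp.1 hq.1)

/-- Two representatives are equivalent if they have the same restriction to some cofinite
subspace (contained in both domains). -/
def Equivalent (φ ψ : AlmostAutRep G R) : Prop :=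
  ∃ S : Set (UnfoldingTree G R), IsCofiniteSubspace S ∧ S ⊆ φ.source ∧ S ⊆ ψ.source ∧
    Set.EqOn φ.toPartialEquiv ψ.toPartialEquiv S

instance setoid (G : MultiDigraph V E) (R : V) : Setoid (AlmostAutRep G R) where
  r := Equivalent
  iseqv :=
    { refl := fun φ =>
        ⟨φ.source, φ.source_cofinite, subset_rfl, subset_rfl, Set.eqOn_refl _ _⟩
      symm := fun ⟨S, hS, h₁, h₂, h⟩ => ⟨S, hS, h₂, h₁, h.symm⟩
      trans := fun ⟨S, hS, h₁, _, h⟩ ⟨S', hS', _, h₂', h'⟩ =>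
        ⟨S ∩ S', hS.inter hS', Set.inter_subset_left.trans h₁, Set.inter_subset_right.trans h₂',
          fun _ hx => (h hx.1).trans (h' hx.2)⟩ }

theorem comp_equivalent {φ φ' ψ ψ' : AlmostAutRep G R} (h : Equivalent φ φ')
    (h' : Equivalent ψ ψ') : Equivalent (φ.comp ψ) (φ'.comp ψ') := by
  obtain ⟨S, hS, h₁, h₂, he⟩ := h
  obtain ⟨S', hS', h₁', h₂', he'⟩ := h'
  refine ⟨S' ∩ (ψ.source ∩ ψ.toPartialEquiv ⁻¹' S), hS'.inter (ψ.preimage_cofinite hS),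
    ?_, ?_, ?_⟩
  · rintro x ⟨_, hx, hxS⟩
    exact (PartialEquiv.trans_source _ _).symm ▸ ⟨hx, h₁ hxS⟩
  · rintro x ⟨hx', _, hxS⟩
    refine (PartialEquiv.trans_source _ _).symm ▸ ⟨h₂' hx', h₂ ?_⟩
    have := he' hx'
    rw [← this]
    exact hxS
  · rintro x ⟨hx', _, hxS⟩
    change φ.toPartialEquiv (ψ.toPartialEquiv x) = φ'.toPartialEquiv (ψ'.toPartialEquiv x)
    rw [← he' hx']
    exact he hxS

theorem symm_equivalent {φ φ' : AlmostAutRep G R} (h : Equivalent φ φ') :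
    Equivalent φ.symm φ'.symm := by
  obtain ⟨S, hS, h₁, h₂, he⟩ := h
  have key : ∀ x ∈ φ.target ∩ φ.toPartialEquiv.symm ⁻¹' S,
      φ'.toPartialEquiv (φ.toPartialEquiv.symm x) = x := by
    rintro x ⟨hx, hxS⟩
    rw [← he hxS]
    exact φ.toPartialEquiv.right_inv hx
  refine ⟨φ.target ∩ φ.toPartialEquiv.symm ⁻¹' S, φ.symm.preimage_cofinite hS,
    Set.inter_subset_left, ?_, ?_⟩
  · intro x hx
    have := φ'.toPartialEquiv.map_source (h₂ hx.2)
    rwa [key x hx] at this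
  · intro x hx
    change φ.toPartialEquiv.symm x = φ'.toPartialEquiv.symm x
    have := φ'.toPartialEquiv.left_inv (h₂ hx.2)
    rw [key x hx] at this
    exact this.symm

/-- Higman-Thompson representatives: for every `b` in the basis of the domain and every walk `p`
originating in the terminal vertex of `b`, `φ (bp) = φ (b) p`. -/
def IsHigmanThompson (φ : AlmostAutRep G R) : Prop :=
  ∀ b ∈ basis φ.source, ∀ p : List E, ∀ h : G.IsWalkFrom R (b.walk ++ p),
    (φ.toPartialEquiv ⟨b.walk ++ p, h⟩).walk = (φ.toPartialEquiv b).walk ++ p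

theorem IsHigmanThompson.map_append {φ : AlmostAutRep G R} (hφ : φ.IsHigmanThompson)
    {x y : UnfoldingTree G R} (hx : x ∈ φ.source) {p : List E} (hy : x.walk ++ p = y.walk) :
    (φ.toPartialEquiv y).walk = (φ.toPartialEquiv x).walk ++ p := by
  obtain ⟨b, hb, r, hr⟩ := exists_basis_le hx
  have hy' : b.walk ++ (r ++ p) = y.walk := by rw [← List.append_assoc, hr, hy]
  have key : ∀ (z : UnfoldingTree G R) (q : List E), b.walk ++ q = z.walk →
      (φ.toPartialEquiv z).walk = (φ.toPartialEquiv b).walk ++ q := by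
    rintro ⟨_, hz⟩ q rfl
    exact hφ b hb q hz
  rw [key y _ hy', key x r hr, List.append_assoc]

theorem IsHigmanThompson.refl : (AlmostAutRep.refl G R).IsHigmanThompson :=
  fun _ _ _ _ => rfl

theorem IsHigmanThompson.symm {φ : AlmostAutRep G R} (hφ : φ.IsHigmanThompson) :
    φ.symm.IsHigmanThompson := by
  intro y hy p h
  have hyt : y ∈ φ.target := hy.1
  have hle : y ≤ ⟨y.walk ++ p, h⟩ := ⟨p, rfl⟩
  have hzt : (⟨y.walk ++ p, h⟩ : UnfoldingTree G R) ∈ φ.target := φ.target_cofinite.2 y hyt _ hle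
  obtain ⟨q, hq⟩ := (φ.symm.map_le_map_iff hyt hzt).2 hle
  have h₁ := hφ.map_append (φ.toPartialEquiv.map_target hyt) hq
  change (φ.toPartialEquiv (φ.toPartialEquiv.symm _)).walk = _ at h₁
  rw [φ.toPartialEquiv.right_inv hyt, φ.toPartialEquiv.right_inv hzt] at h₁
  have h₂ : p = q := List.append_cancel_left h₁
  subst h₂
  exact hq.symm

theorem IsHigmanThompson.comp {φ ψ : AlmostAutRep G R} (hφ : φ.IsHigmanThompson)
    (hψ : ψ.IsHigmanThompson) : (φ.comp ψ).IsHigmanThompson := by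
  intro b hb p h
  have hb' : b ∈ (ψ.toPartialEquiv.trans φ.toPartialEquiv).source := hb.1
  rw [PartialEquiv.trans_source] at hb'
  exact hφ.map_append hb'.2 (hψ.map_append hb'.1 rfl).symm

end AlmostAutRep

/-- The almost automorphisms of the unfolding tree: equivalence classes of representatives. -/
def AlmostAut (G : MultiDigraph V E) (R : V) : Type u₂ :=
  Quotient (AlmostAutRep.setoid G R)

/-- The group of almost automorphisms, under composition. -/
instance AlmostAut.instGroup (G : MultiDigraph V E) (R : V) : Group (AlmostAut G R) where
  mul := Quotient.map₂ AlmostAutRep.comp fun _ _ h _ _ h' => AlmostAutRep.comp_equivalent h h'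
  one := Quotient.mk _ (AlmostAutRep.refl G R)
  inv := Quotient.map AlmostAutRep.symm fun _ _ h => AlmostAutRep.symm_equivalent h
  mul_assoc := by
    rintro ⟨a⟩ ⟨b⟩ ⟨c⟩
    exact Quotient.sound ⟨((a.comp b).comp c).source, ((a.comp b).comp c).source_cofinite,
      subset_rfl, fun x hx => ⟨⟨hx.1, hx.2.1⟩, hx.2.2⟩, fun _ _ => rfl⟩
  one_mul := by
    rintro ⟨a⟩
    exact Quotient.sound ⟨a.source, a.source_cofinite, fun x hx => ⟨hx, trivial⟩,
      subset_rfl, fun _ _ => rfl⟩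
  mul_one := by
    rintro ⟨a⟩
    exact Quotient.sound ⟨a.source, a.source_cofinite, fun x hx => ⟨trivial, hx⟩,
      subset_rfl, fun _ _ => rfl⟩
  inv_mul_cancel := by
    rintro ⟨a⟩
    exact Quotient.sound ⟨a.source, a.source_cofinite,
      fun x hx => ⟨hx, a.toPartialEquiv.map_source hx⟩, fun _ _ => trivial,
      fun x hx => a.toPartialEquiv.left_inv hx⟩

/-- The Higman-Thompson group of the unfolding tree of `G` based on `R`: the subgroup of all
almost automorphisms that have a Higman-Thompson representative. -/
def higmanThompson (G : MultiDigraph V E) (R : V) : Subgroup (AlmostAut G R) where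
  carrier := {g | ∃ φ : AlmostAutRep G R, φ.IsHigmanThompson ∧ Quotient.mk _ φ = g}
  mul_mem' := by
    rintro _ _ ⟨φ, hφ, rfl⟩ ⟨ψ, hψ, rfl⟩
    exact ⟨φ.comp ψ, hφ.comp hψ, rfl⟩
  one_mem' := ⟨_, AlmostAutRep.IsHigmanThompson.refl, rfl⟩
  inv_mem' := by
    rintro _ ⟨φ, hφ, rfl⟩
    exact ⟨φ.symm, hφ.symm, rfl⟩

/-- The graph `G(w ↪ v)` determined by a map `θ : o⁻¹(w) → o⁻¹(v)`: the vertices of `G` are kept,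
the edges in the image of `θ` are removed, and one new edge `none`, from `v` to `w`, is added. -/
def shift (G : MultiDigraph V E) {v w : V} (θ : {e : E // G.o e = w} → {e : E // G.o e = v}) :
    MultiDigraph V (Option {e : E // ∀ a, (θ a : E) ≠ e}) where
  o
    | none => v
    | some e => G.o e.1
  t
    | none => w
    | some e => G.t e.1

end MultiDigraph

/-! Write f for the new edge. Replacing every edge `θ a` of a walk by f followed by `a` embeds the
tree of G into the tree of G(w ↪ v). It respects extension and termini, because f a runs from v
through w to t(a) = t(θ a). Since v ≠ w, edges at w are never removed and f never follows itself, so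
the replacement can be undone: each walk of the new graph is uniquely the image of a walk of G,
followed by nothing or by a single f (`exists_shiftWalk_append`, `shiftWalk_append_inj`). The image
is thus the set of walks not ending in f.

A representative φ on the old tree is transported by fixing the possible trailing f; this needs φ to
preserve termini. A representative ψ on the new tree is restricted to the image; this needs ψ to
preserve the property of ending in f. Both hold off the basis of the domain, where the last edge is
preserved (`exists_last_edge`), and by row-finiteness the basis is finite and can be discarded.

Being intertwined by the embedding is then a relation between the two groups that is total on both
sides, compatible with composition, functional and injective: the graph of an isomorphism. -/

namespace MultiDigraph

variable {V : Type u₁} {E : Type u₂}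

/-! ### Concatenation of walks. -/

section Walks

variable (G : MultiDigraph V E)

theorem isWalkFrom_append (u : V) (p q : List E) :
    G.IsWalkFrom u (p ++ q) ↔ G.IsWalkFrom u p ∧ G.IsWalkFrom (G.terminus u p) q := by
  induction p generalizing u with
  | nil => simp [IsWalkFrom, terminus]
  | cons e p ih => simp [IsWalkFrom, terminus, ih, and_assoc]

theorem terminus_append (u : V) (p q : List E) :
    G.terminus u (p ++ q) = G.terminus (G.terminus u p) q := by
  induction p generalizing u with
  | nil => rfl
  | cons e p ih => simp [terminus, ih]

theorem terminus_concat (u : V) (p : List E) (e : E) : G.terminus u (p ++ [e]) = G.t e := by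
  rw [terminus_append]
  rfl

end Walks

/-! ### Finiteness of bases. -/

namespace UnfoldingTree

variable {G : MultiDigraph V E} {R : V}

/-- Provides the irrelevant values of inverse functions off their range, for
`Set.BijOn.toPartialEquiv`. -/
instance : Nonempty (UnfoldingTree G R) := ⟨⟨[], trivial⟩⟩

/-- In a row-finite graph the basis of a cofinite subspace is finite. -/
theorem IsCofiniteSubspace.finite_basis (hG : G.RowFinite) {S : Set (UnfoldingTree G R)}
    (hS : IsCofiniteSubspace S) : (basis S).Finite := by
  -- By minimality, deleting the last edge of a nonempty basis walk leads into the finite complement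
  -- of `S`.
  have hsub : UnfoldingTree.walk '' basis S ⊆ {[]} ∪
      ⋃ l ∈ Sᶜ, (fun e => l.walk ++ [e]) '' {e | G.o e = G.terminus R l.walk} := by
    rintro _ ⟨b, hb, rfl⟩
    rcases List.eq_nil_or_concat b.walk with h | ⟨l, e, h⟩
    · exact Or.inl h
    · right
      rw [List.concat_eq_append] at h
      have hw := b.isWalk
      rw [h, isWalkFrom_append] at hw
      simp only [Set.mem_iUnion]
      refine ⟨⟨l, hw.1⟩, fun hl => ?_, e, hw.2.1, h.symm⟩
      have hle : (⟨l, hw.1⟩ : UnfoldingTree G R) ≤ b := ⟨[e], h.symm⟩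
      have := List.IsPrefix.length_le (hb.2 hl hle)
      simp [h] at this
  refine Set.Finite.of_finite_image (f := UnfoldingTree.walk) (Set.Finite.subset ?_ hsub)
    (fun _ _ _ _ h => UnfoldingTree.ext h)
  exact (Set.finite_singleton _).union (hS.1.biUnion fun l _ => (hG _).image _)

end UnfoldingTree

open UnfoldingTree

/-! ### Building representatives, and their behaviour off the basis. -/

namespace AlmostAutRep

variable {G : MultiDigraph V E} {R : V}

/-- A map on a cofinite subspace that is compatible with extension of walks, injective, preserves
terminal vertices and has cofinite image is a Higman-Thompson representative. -/
theorem exists_isHigmanThompson {S : Set (UnfoldingTree G R)}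
    (hS : IsCofiniteSubspace S) (f : UnfoldingTree G R → UnfoldingTree G R) (hinj : Set.InjOn f S)
    (hfin : (f '' S)ᶜ.Finite)
    (hter : ∀ x ∈ S, G.terminus R (f x).walk = G.terminus R x.walk)
    (happ : ∀ x ∈ S, ∀ y p, x.walk ++ p = y.walk → (f y).walk = (f x).walk ++ p) :
    ∃ φ : AlmostAutRep G R, φ.IsHigmanThompson ∧ φ.source = S ∧
      ∀ x, φ.toPartialEquiv x = f x := by
  -- As `x` and `f x` have the same terminus, whatever extends `f x` also extends `x`. This makes
  -- the image closed under extension and lets `f` reflect the order.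
  have key : ∀ x ∈ S, ∀ z, f x ≤ z → ∃ y ∈ S, x ≤ y ∧ f y = z := by
    rintro x hx z ⟨r, hr⟩
    have hw := z.isWalk
    rw [← hr, isWalkFrom_append, hter x hx] at hw
    let y : UnfoldingTree G R := ⟨x.walk ++ r, (isWalkFrom_append ..).2 ⟨x.isWalk, hw.2⟩⟩
    have hxy : x ≤ y := ⟨r, rfl⟩
    exact ⟨y, hS.2 x hx y hxy, hxy,
      UnfoldingTree.ext ((happ x hx y r rfl).trans hr)⟩
  refine ⟨{ toPartialEquiv := Set.BijOn.toPartialEquiv f S (f '' S) hinj.bijOn_image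
            source_cofinite := hS
            target_cofinite := ⟨hfin, ?_⟩
            map_le_map_iff' := ?_ }, ?_, rfl, fun _ => rfl⟩
  · rintro _ ⟨x, hx, rfl⟩ z hz
    obtain ⟨y, hy, -, rfl⟩ := key x hx z hz
    exact ⟨y, hy, rfl⟩
  · intro x hx y hy
    constructor
    · intro h
      obtain ⟨y', hy', hxy', he⟩ := key x hx _ h
      rwa [hinj hy' hy he] at hxy'
    · rintro ⟨p, hp⟩
      exact ⟨p, (happ x hx y p hp).symm⟩
  · intro b hb p h
    exact happ b hb.1 _ p rfl

/-- Outside the basis of its domain, a Higman-Thompson representative preserves the last edge of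
walks. -/
theorem IsHigmanThompson.exists_last_edge {φ : AlmostAutRep G R} (hφ : φ.IsHigmanThompson)
    {x : UnfoldingTree G R} (hx : x ∈ φ.source \ basis φ.source) :
    ∃ l l' e, x.walk = l ++ [e] ∧ (φ.toPartialEquiv x).walk = l' ++ [e] := by
  obtain ⟨b, hb, p, hp⟩ := exists_basis_le hx.1
  rcases List.eq_nil_or_concat p with rfl | ⟨l, e, rfl⟩
  · refine (hx.2 ?_).elim
    rw [List.append_nil] at hp
    rwa [← UnfoldingTree.ext hp]
  · have h := hφ.map_append hb.1 hp
    rw [List.concat_eq_append, ← List.append_assoc] at h hp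
    exact ⟨_, _, e, hp.symm, h⟩

theorem IsHigmanThompson.terminus_eq {φ : AlmostAutRep G R} (hφ : φ.IsHigmanThompson)
    {x : UnfoldingTree G R} (hx : x ∈ φ.source \ basis φ.source) :
    G.terminus R (φ.toPartialEquiv x).walk = G.terminus R x.walk := by
  obtain ⟨l, l', e, h, h'⟩ := hφ.exists_last_edge hx
  rw [h, h', terminus_concat, terminus_concat]

/-- Passing to a smaller cofinite domain does not affect the class. On basis elements the last edge,
and at sinks even the terminus, may change, so they are dropped. -/
theorem cofinite_diff_basis (hG : G.RowFinite) (φ : AlmostAutRep G R) :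
    IsCofiniteSubspace (φ.source \ basis φ.source) := by
  refine ⟨?_, fun p hp q hpq => ⟨φ.source_cofinite.2 p hp.1 q hpq, fun hq => hp.2 ?_⟩⟩
  · rw [Set.sdiff_eq, Set.compl_inter, compl_compl]
    exact φ.source_cofinite.1.union (φ.source_cofinite.finite_basis hG)
  · rwa [le_antisymm hpq (hq.2 hp.1 hpq)]

theorem finite_compl_image_diff_basis (hG : G.RowFinite) (φ : AlmostAutRep G R) :
    (φ.toPartialEquiv '' (φ.source \ basis φ.source))ᶜ.Finite := by
  refine (φ.target_cofinite.1.union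
    ((φ.source_cofinite.finite_basis hG).image φ.toPartialEquiv)).subset fun y hy => ?_
  by_cases h : y ∈ φ.target
  · right
    by_contra hn
    refine hy ⟨φ.toPartialEquiv.symm y, ⟨φ.toPartialEquiv.map_target h, fun hb => hn ?_⟩,
      φ.toPartialEquiv.right_inv h⟩
    exact ⟨_, hb, φ.toPartialEquiv.right_inv h⟩
  · exact Or.inl h

end AlmostAutRep

/-! ### Replacing edges in walks: a uniquely decodable code. -/

section Shift

variable {G : MultiDigraph V E} {v w : V}
  {θ : {e : E // G.o e = w} → {e : E // G.o e = v}}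

theorem RowFinite.shift (hG : G.RowFinite) : (G.shift θ).RowFinite := by
  intro u
  have h : ((fun e : {e : E // ∀ a, (θ a : E) ≠ e} => some e) ''
      (Subtype.val ⁻¹' {e : E | G.o e = u})).Finite :=
    ((hG u).preimage Subtype.val_injective.injOn).image _
  refine (h.union (Set.finite_singleton none)).subset ?_
  rintro (_ | e) he
  · exact Or.inr rfl
  · exact Or.inl ⟨e, he, rfl⟩

theorem coe_ne_of_origin_eq (hvw : v ≠ w) (a : {e : E // G.o e = w})
    (b : {e : E // G.o e = w}) : (θ b : E) ≠ a := fun h =>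
  hvw ((θ b).2.symm.trans ((congrArg G.o h).trans a.2))

open Classical in
/-- The walk of `G(w ↪ v)` that replaces an edge of `G`: an edge `θ e` is replaced by the new edge
followed by `e`, any other edge is kept. -/
noncomputable def shiftEdge (θ : {e : E // G.o e = w} → {e : E // G.o e = v}) (hvw : v ≠ w)
    (e : E) : List (Option {e : E // ∀ a, (θ a : E) ≠ e}) :=
  if h : ∃ a, (θ a : E) = e then [none, some ⟨h.choose, coe_ne_of_origin_eq hvw h.choose⟩]
  else [some ⟨e, not_exists.1 h⟩]

/-- The walk of `G(w ↪ v)` that replaces a walk of `G`. -/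
noncomputable def shiftWalk (θ : {e : E // G.o e = w} → {e : E // G.o e = v}) (hvw : v ≠ w)
    (p : List E) : List (Option {e : E // ∀ a, (θ a : E) ≠ e}) :=
  p.flatMap (shiftEdge θ hvw)

variable (hvw : v ≠ w)

theorem shiftEdge_coe (hθ : Function.Injective θ) (a : {e : E // G.o e = w}) :
    shiftEdge θ hvw (θ a) = [none, some ⟨a, coe_ne_of_origin_eq hvw a⟩] := by
  have h : ∃ b, (θ b : E) = θ a := ⟨a, rfl⟩
  have h' : h.choose = a := hθ (Subtype.ext h.choose_spec)
  rw [shiftEdge, dif_pos h]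
  simp only [h']

theorem shiftEdge_of_ne {e : E} (h : ∀ a, (θ a : E) ≠ e) :
    shiftEdge θ hvw e = [some ⟨e, h⟩] := by
  rw [shiftEdge, dif_neg (not_exists.2 h)]

theorem shiftWalk_append (p q : List E) :
    shiftWalk θ hvw (p ++ q) = shiftWalk θ hvw p ++ shiftWalk θ hvw q :=
  List.flatMap_append

theorem shiftWalk_cons (e : E) (q : List E) :
    shiftWalk θ hvw (e :: q) = shiftEdge θ hvw e ++ shiftWalk θ hvw q :=
  List.flatMap_cons

/-- Every block `shiftEdge θ hvw e` ends in an old edge. -/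
theorem shiftWalk_ne_concat_none (hθ : Function.Injective θ) (p : List E)
    (l : List (Option {e : E // ∀ a, (θ a : E) ≠ e})) : shiftWalk θ hvw p ≠ l ++ [none] := by
  intro hp
  have h := congrArg List.getLast? hp
  rcases List.eq_nil_or_concat p with rfl | ⟨p, e, rfl⟩
  · simp [shiftWalk] at h
  · rw [List.concat_eq_append, shiftWalk_append, shiftWalk_cons] at h
    by_cases he : ∃ a, (θ a : E) = e
    · obtain ⟨a, rfl⟩ := he
      simp [shiftEdge_coe hvw hθ, shiftWalk] at h
    · simp [shiftEdge_of_ne hvw (not_exists.1 he), shiftWalk] at h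

theorem isWalkFrom_shiftWalk (hθ : Function.Injective θ)
    (ht : ∀ e : {e : E // G.o e = w}, G.t (θ e) = G.t e) (u : V) (p : List E) :
    ((G.shift θ).IsWalkFrom u (shiftWalk θ hvw p) ↔ G.IsWalkFrom u p) ∧
      (G.shift θ).terminus u (shiftWalk θ hvw p) = G.terminus u p := by
  induction p generalizing u with
  | nil => exact ⟨Iff.rfl, rfl⟩
  | cons e p ih =>
    rw [shiftWalk_cons]
    by_cases he : ∃ a, (θ a : E) = e
    · obtain ⟨a, rfl⟩ := he
      rw [shiftEdge_coe hvw hθ]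
      simp [IsWalkFrom, terminus, shift, ht] at ih ⊢
      simp [ih, a.2, (θ a).2]
    · rw [shiftEdge_of_ne hvw (not_exists.1 he)]
      simp [IsWalkFrom, terminus, shift] at ih ⊢
      simp [ih]

/-- The blocks form a prefix code: an initial `none` announces a block of length two, whose second
letter determines `a` and hence `θ a`. A trailing `none` is an incomplete block, so it cannot hide a
further edge of `p`. -/
theorem prefix_of_shiftWalk_append (hθ : Function.Injective θ) {p q : List E}
    {x s : List (Option {e : E // ∀ a, (θ a : E) ≠ e})} (hs : s = [] ∨ s = [none])
    (h : shiftWalk θ hvw p ++ x = shiftWalk θ hvw q ++ s) : p <+: q := by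
  induction p generalizing q with
  | nil => exact List.nil_prefix
  | cons e p ih =>
    have main : ∃ q', q = e :: q' := by
      cases q with
      | nil =>
        by_cases he : ∃ a, (θ a : E) = e
        · obtain ⟨a, rfl⟩ := he
          rw [shiftWalk_cons, shiftEdge_coe hvw hθ] at h
          rcases hs with rfl | rfl <;> simp [shiftWalk] at h
        · rw [shiftWalk_cons, shiftEdge_of_ne hvw (not_exists.1 he)] at h
          rcases hs with rfl | rfl <;> simp [shiftWalk] at h
      | cons c q =>
        refine ⟨q, ?_⟩
        congr 1
        rw [shiftWalk_cons, shiftWalk_cons] at h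
        by_cases he : ∃ a, (θ a : E) = e <;> by_cases hc : ∃ a, (θ a : E) = c
        · obtain ⟨a, rfl⟩ := he
          obtain ⟨b, rfl⟩ := hc
          rw [shiftEdge_coe hvw hθ, shiftEdge_coe hvw hθ] at h
          simp [Subtype.coe_inj] at h
          rw [h.1]
        · obtain ⟨a, rfl⟩ := he
          rw [shiftEdge_coe hvw hθ, shiftEdge_of_ne hvw (not_exists.1 hc)] at h
          simp at h
        · obtain ⟨a, rfl⟩ := hc
          rw [shiftEdge_coe hvw hθ, shiftEdge_of_ne hvw (not_exists.1 he)] at h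
          simp at h
        · rw [shiftEdge_of_ne hvw (not_exists.1 he), shiftEdge_of_ne hvw (not_exists.1 hc)] at h
          simp at h
          exact h.1.symm
    obtain ⟨q', rfl⟩ := main
    rw [shiftWalk_cons, shiftWalk_cons, List.append_assoc, List.append_assoc] at h
    exact List.cons_prefix_cons.2 ⟨rfl, ih (List.append_cancel_left h)⟩

theorem shiftWalk_append_inj (hθ : Function.Injective θ) {p q : List E}
    {r s : List (Option {e : E // ∀ a, (θ a : E) ≠ e})} (hr : r = [] ∨ r = [none])
    (hs : s = [] ∨ s = [none]) (h : shiftWalk θ hvw p ++ r = shiftWalk θ hvw q ++ s) :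
    p = q ∧ r = s := by
  have h₁ := prefix_of_shiftWalk_append hvw hθ hs h
  have h₂ := prefix_of_shiftWalk_append hvw hθ hr h.symm
  obtain rfl := h₁.eq_of_length (le_antisymm h₁.length_le h₂.length_le)
  exact ⟨rfl, List.append_cancel_left h⟩

/-- Every walk of `G(w ↪ v)` comes from a walk of `G`, up to a final new edge. -/
theorem exists_shiftWalk_append (hθ : Function.Injective θ)
    (ht : ∀ e : {e : E // G.o e = w}, G.t (θ e) = G.t e) :
    ∀ (u : V) (p : List (Option {e : E // ∀ a, (θ a : E) ≠ e})), (G.shift θ).IsWalkFrom u p →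
      ∃ q s, (s = [] ∨ s = [none]) ∧ G.IsWalkFrom u q ∧ p = shiftWalk θ hvw q ++ s
  | _, [], _ => ⟨[], [], Or.inl rfl, trivial, rfl⟩
  | _, some e :: p, h => by
    obtain ⟨q, s, hs, hq, rfl⟩ := exists_shiftWalk_append hθ ht _ p h.2
    refine ⟨e :: q, s, hs, ⟨h.1, hq⟩, ?_⟩
    rw [shiftWalk_cons, shiftEdge_of_ne hvw e.2]
    rfl
  | _, [none], _ => ⟨[], [none], Or.inr rfl, trivial, rfl⟩
  -- The first new edge ends in `w`, whereas the second starts in `v`.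
  | _, none :: none :: _, h => (hvw h.2.1).elim
  | _, none :: some e :: p, h => by
    obtain ⟨q, s, hs, hq, rfl⟩ := exists_shiftWalk_append hθ ht _ p h.2.2
    have he : G.o e = w := h.2.1
    refine ⟨θ ⟨e, he⟩ :: q, s, hs, ⟨(θ ⟨e, he⟩).2.trans h.1, ?_⟩, ?_⟩
    · rw [ht]
      exact hq
    · rw [shiftWalk_cons, shiftEdge_coe hvw hθ]
      rfl

end Shift

/-! ### The embedding of trees and its one-sided inverse. -/

section ShiftTree

variable {G : MultiDigraph V E} {R v w : V}
  {θ : {e : E // G.o e = w} → {e : E // G.o e = v}} (hvw : v ≠ w) (hθ : Function.Injective θ)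
  (ht : ∀ e : {e : E // G.o e = w}, G.t (θ e) = G.t e)

/-- The embedding of the unfolding tree of `G` into that of `G(w ↪ v)`. -/
noncomputable def shiftVertex (x : UnfoldingTree G R) : UnfoldingTree (G.shift θ) R where
  walk := shiftWalk θ hvw x.walk
  isWalk := (isWalkFrom_shiftWalk hvw hθ ht R x.walk).1.2 x.isWalk

theorem shiftVertex_injective : Function.Injective (shiftVertex (R := R) hvw hθ ht) := by
  intro x y h
  -- The empty rests bring the equation into the form of `shiftWalk_append_inj`.
  have h' : shiftWalk θ hvw x.walk ++ [] = shiftWalk θ hvw y.walk ++ [] :=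
    congrArg (fun z => z.walk ++ []) h
  exact UnfoldingTree.ext (shiftWalk_append_inj hvw hθ (Or.inl rfl) (Or.inl rfl) h').1

theorem shiftVertex_mono {x y : UnfoldingTree G R} (h : x ≤ y) :
    shiftVertex hvw hθ ht x ≤ shiftVertex hvw hθ ht y := by
  obtain ⟨p, hp⟩ := h
  refine ⟨shiftWalk θ hvw p, ?_⟩
  change shiftWalk θ hvw x.walk ++ _ = shiftWalk θ hvw y.walk
  rw [← hp, shiftWalk_append]

theorem terminus_shiftVertex (x : UnfoldingTree G R) :
    (G.shift θ).terminus R (shiftVertex hvw hθ ht x).walk = G.terminus R x.walk :=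
  (isWalkFrom_shiftWalk hvw hθ ht R x.walk).2

theorem cofinite_preimage_shiftVertex {S : Set (UnfoldingTree (G.shift θ) R)}
    (hS : IsCofiniteSubspace S) : IsCofiniteSubspace (shiftVertex hvw hθ ht ⁻¹' S) :=
  ⟨hS.1.preimage (shiftVertex_injective hvw hθ ht).injOn,
    fun _ hp _ hpq => hS.2 _ hp _ (shiftVertex_mono hvw hθ ht hpq)⟩

theorem exists_shiftVertex (y : UnfoldingTree (G.shift θ) R) :
    ∃ (x : UnfoldingTree G R) (s : List (Option {e : E // ∀ a, (θ a : E) ≠ e})),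
      (s = [] ∨ s = [none]) ∧ y.walk = (shiftVertex hvw hθ ht x).walk ++ s := by
  obtain ⟨q, s, hs, hq, h⟩ := exists_shiftWalk_append hvw hθ ht R y.walk y.isWalk
  exact ⟨⟨q, hq⟩, s, hs, h⟩

/-- A walk of `G(w ↪ v)` that does not end in the new edge comes from a walk of `G`. -/
theorem exists_shiftVertex_eq {y : UnfoldingTree (G.shift θ) R}
    (hy : ∀ l, y.walk ≠ l ++ [none]) : ∃ x, shiftVertex hvw hθ ht x = y := by
  obtain ⟨x, s, rfl | rfl, h⟩ := exists_shiftVertex hvw hθ ht y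
  · exact ⟨x, UnfoldingTree.ext (by simpa using h.symm)⟩
  · exact (hy _ h).elim

/-- The longest walk of `G` whose replacement is a prefix of the given walk of `G(w ↪ v)`. -/
noncomputable def unshiftVertex (y : UnfoldingTree (G.shift θ) R) : UnfoldingTree G R :=
  (exists_shiftVertex hvw hθ ht y).choose

/-- The part of a walk of `G(w ↪ v)` not accounted for by `unshiftVertex`. -/
noncomputable def unshiftRest (y : UnfoldingTree (G.shift θ) R) :
    List (Option {e : E // ∀ a, (θ a : E) ≠ e}) :=
  (exists_shiftVertex hvw hθ ht y).choose_spec.choose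

theorem unshiftRest_eq (y : UnfoldingTree (G.shift θ) R) :
    unshiftRest hvw hθ ht y = [] ∨ unshiftRest hvw hθ ht y = [none] :=
  (exists_shiftVertex hvw hθ ht y).choose_spec.choose_spec.1

theorem walk_eq_unshift (y : UnfoldingTree (G.shift θ) R) :
    y.walk = shiftWalk θ hvw (unshiftVertex hvw hθ ht y).walk ++ unshiftRest hvw hθ ht y :=
  (exists_shiftVertex hvw hθ ht y).choose_spec.choose_spec.2

theorem unshift_eq {y : UnfoldingTree (G.shift θ) R} {x : UnfoldingTree G R}
    {s : List (Option {e : E // ∀ a, (θ a : E) ≠ e})} (hs : s = [] ∨ s = [none])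
    (h : y.walk = shiftWalk θ hvw x.walk ++ s) :
    unshiftVertex hvw hθ ht y = x ∧ unshiftRest hvw hθ ht y = s := by
  rw [walk_eq_unshift hvw hθ ht y] at h
  obtain ⟨h₁, h₂⟩ := shiftWalk_append_inj hvw hθ (unshiftRest_eq hvw hθ ht y) hs h
  exact ⟨UnfoldingTree.ext h₁, h₂⟩

theorem unshift_injective {y z : UnfoldingTree (G.shift θ) R}
    (h : unshiftVertex hvw hθ ht y = unshiftVertex hvw hθ ht z)
    (h' : unshiftRest hvw hθ ht y = unshiftRest hvw hθ ht z) : y = z := by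
  apply UnfoldingTree.ext
  rw [walk_eq_unshift hvw hθ ht y, walk_eq_unshift hvw hθ ht z, h, h']

theorem unshiftVertex_mono {y z : UnfoldingTree (G.shift θ) R} (h : y ≤ z) :
    unshiftVertex hvw hθ ht y ≤ unshiftVertex hvw hθ ht z := by
  obtain ⟨p, hp⟩ := h
  rw [walk_eq_unshift hvw hθ ht y, walk_eq_unshift hvw hθ ht z, List.append_assoc] at hp
  exact prefix_of_shiftWalk_append hvw hθ (unshiftRest_eq hvw hθ ht z) hp

theorem finite_preimage_unshiftVertex {A : Set (UnfoldingTree G R)} (hA : A.Finite) :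
    (unshiftVertex hvw hθ ht ⁻¹' A).Finite := by
  -- A walk is determined by its decoded part and its rest, and there are only two possible rests.
  have hfin : (A ×ˢ {([] : List (Option {e : E // ∀ a, (θ a : E) ≠ e})), [none]}).Finite :=
    hA.prod (Set.toFinite _)
  refine (hfin.preimage (f := fun y => (unshiftVertex hvw hθ ht y, unshiftRest hvw hθ ht y))
    fun y _ z _ h => ?_).subset fun y hy => ⟨hy, unshiftRest_eq hvw hθ ht y⟩
  exact unshift_injective hvw hθ ht (congrArg Prod.fst h) (congrArg Prod.snd h)

theorem cofinite_preimage_unshiftVertex {S : Set (UnfoldingTree G R)}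
    (hS : IsCofiniteSubspace S) : IsCofiniteSubspace (unshiftVertex hvw hθ ht ⁻¹' S) :=
  ⟨finite_preimage_unshiftVertex hvw hθ ht hS.1,
    fun _ hp _ hpq => hS.2 _ hp _ (unshiftVertex_mono hvw hθ ht hpq)⟩

end ShiftTree

/-! ### Transporting representatives and the group isomorphism. -/

section Correspondence

variable {G : MultiDigraph V E} {R v w : V}
  {θ : {e : E // G.o e = w} → {e : E // G.o e = v}} (hvw : v ≠ w) (hθ : Function.Injective θ)
  (ht : ∀ e : {e : E // G.o e = w}, G.t (θ e) = G.t e)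

/-- The embedding of trees intertwines the two representatives on some cofinite subspace. -/
def ShiftRelated (φ : AlmostAutRep G R) (ψ : AlmostAutRep (G.shift θ) R) : Prop :=
  ∃ S : Set (UnfoldingTree G R), IsCofiniteSubspace S ∧ S ⊆ φ.source ∧
    ∀ x ∈ S, shiftVertex hvw hθ ht x ∈ ψ.source ∧
      ψ.toPartialEquiv (shiftVertex hvw hθ ht x) = shiftVertex hvw hθ ht (φ.toPartialEquiv x)

theorem ShiftRelated.comp {φ φ' : AlmostAutRep G R} {ψ ψ' : AlmostAutRep (G.shift θ) R}
    (h : ShiftRelated hvw hθ ht φ ψ) (h' : ShiftRelated hvw hθ ht φ' ψ') :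
    ShiftRelated hvw hθ ht (φ.comp φ') (ψ.comp ψ') := by
  obtain ⟨S, hS, hsub, he⟩ := h
  obtain ⟨S', hS', hsub', he'⟩ := h'
  refine ⟨S' ∩ (φ'.source ∩ φ'.toPartialEquiv ⁻¹' S), hS'.inter (φ'.preimage_cofinite hS),
    fun x hx => ?_, fun x hx => ⟨?_, ?_⟩⟩
  · exact (PartialEquiv.trans_source _ _).symm ▸ ⟨hx.2.1, hsub hx.2.2⟩
  · refine (PartialEquiv.trans_source _ _).symm ▸ ⟨(he' x hx.1).1, ?_⟩
    rw [Set.mem_preimage, (he' x hx.1).2]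
    exact (he _ hx.2.2).1
  · change ψ.toPartialEquiv (ψ'.toPartialEquiv _) = _
    rw [(he' x hx.1).2, (he _ hx.2.2).2]
    rfl

/-- Each `y` extends the image of its decoded part by its rest, so the Higman-Thompson property
determines `ψ` at `y` from its values on the image of the embedding. -/
theorem ShiftRelated.equivalent_right {φ φ' : AlmostAutRep G R}
    {ψ ψ' : AlmostAutRep (G.shift θ) R} (hψ : ψ.IsHigmanThompson) (hψ' : ψ'.IsHigmanThompson)
    (hφ : AlmostAutRep.Equivalent φ φ')
    (h : ShiftRelated hvw hθ ht φ ψ) (h' : ShiftRelated hvw hθ ht φ' ψ') :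
    AlmostAutRep.Equivalent ψ ψ' := by
  obtain ⟨S, hS, -, he⟩ := h
  obtain ⟨S', hS', -, he'⟩ := h'
  obtain ⟨T, hT, -, -, heq⟩ := hφ
  have hle : ∀ y : UnfoldingTree (G.shift θ) R,
      shiftVertex hvw hθ ht (unshiftVertex hvw hθ ht y) ≤ y :=
    fun y => ⟨_, (walk_eq_unshift hvw hθ ht y).symm⟩
  refine ⟨_, cofinite_preimage_unshiftVertex hvw hθ ht ((hS.inter hS').inter hT),
    fun y hy => ψ.source_cofinite.2 _ (he _ hy.1.1).1 y (hle y),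
    fun y hy => ψ'.source_cofinite.2 _ (he' _ hy.1.2).1 y (hle y), fun y hy => ?_⟩
  apply UnfoldingTree.ext
  have hw := (walk_eq_unshift hvw hθ ht y).symm
  rw [hψ.map_append (he _ hy.1.1).1 hw, hψ'.map_append (he' _ hy.1.2).1 hw,
    (he _ hy.1.1).2, (he' _ hy.1.2).2, heq hy.2]

theorem ShiftRelated.equivalent_left {φ φ' : AlmostAutRep G R}
    {ψ ψ' : AlmostAutRep (G.shift θ) R} (hψ : AlmostAutRep.Equivalent ψ ψ')
    (h : ShiftRelated hvw hθ ht φ ψ) (h' : ShiftRelated hvw hθ ht φ' ψ') :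
    AlmostAutRep.Equivalent φ φ' := by
  obtain ⟨S, hS, hsub, he⟩ := h
  obtain ⟨S', hS', hsub', he'⟩ := h'
  obtain ⟨T, hT, -, -, heq⟩ := hψ
  refine ⟨_, (hS.inter hS').inter (cofinite_preimage_shiftVertex hvw hθ ht hT),
    fun x hx => hsub hx.1.1, fun x hx => hsub' hx.1.2, fun x hx => ?_⟩
  apply shiftVertex_injective hvw hθ ht
  rw [← (he _ hx.1.1).2, ← (he' _ hx.1.2).2, heq hx.2]

theorem exists_shiftRelated_right (hG : G.RowFinite) {φ : AlmostAutRep G R}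
    (hφ : φ.IsHigmanThompson) :
    ∃ ψ : AlmostAutRep (G.shift θ) R, ψ.IsHigmanThompson ∧ ShiftRelated hvw hθ ht φ ψ := by
  set S := φ.source \ basis φ.source
  have hS : IsCofiniteSubspace S := φ.cofinite_diff_basis hG
  -- The transported map acts on the decoded part by `φ` and keeps the rest; elsewhere its value is
  -- arbitrary.
  have hwalk : ∀ y, ∃ z : UnfoldingTree (G.shift θ) R, unshiftVertex hvw hθ ht y ∈ S →
      z.walk = shiftWalk θ hvw (φ.toPartialEquiv (unshiftVertex hvw hθ ht y)).walk ++
        unshiftRest hvw hθ ht y := by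
    intro y
    by_cases hy : unshiftVertex hvw hθ ht y ∈ S
    · refine ⟨⟨_, ?_⟩, fun _ => rfl⟩
      -- The rest can still follow the new decoded part because `φ` preserves termini on `S`.
      have hw := y.isWalk
      rw [walk_eq_unshift hvw hθ ht y, isWalkFrom_append,
        (isWalkFrom_shiftWalk hvw hθ ht R _).2, ← hφ.terminus_eq hy] at hw
      rw [isWalkFrom_append, (isWalkFrom_shiftWalk hvw hθ ht R _).2]
      exact ⟨(isWalkFrom_shiftWalk hvw hθ ht R _).1.2 (UnfoldingTree.isWalk _), hw.2⟩
    · exact ⟨y, fun h => (hy h).elim⟩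
  choose f hf using hwalk
  refine Exists.imp (fun ψ ⟨hψ, hsource, hfun⟩ => ?_)
    (AlmostAutRep.exists_isHigmanThompson
      (cofinite_preimage_unshiftVertex hvw hθ ht hS) f ?_ ?_ ?_ ?_)
  · intro y hy z hz h
    have h' := congrArg UnfoldingTree.walk h
    rw [hf y hy, hf z hz] at h'
    obtain ⟨h₁, h₂⟩ := shiftWalk_append_inj hvw hθ (unshiftRest_eq hvw hθ ht y)
      (unshiftRest_eq hvw hθ ht z) h'
    exact unshift_injective hvw hθ ht
      (φ.toPartialEquiv.injOn hy.1 hz.1 (UnfoldingTree.ext h₁)) h₂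
  · refine (finite_preimage_unshiftVertex hvw hθ ht
      (φ.finite_compl_image_diff_basis hG)).subset fun z hz hmem => hz ?_
    obtain ⟨x, hx, hxz⟩ := hmem
    have hw := z.isWalk
    rw [walk_eq_unshift hvw hθ ht z, isWalkFrom_append,
      (isWalkFrom_shiftWalk hvw hθ ht R _).2, ← hxz, hφ.terminus_eq hx] at hw
    let y : UnfoldingTree (G.shift θ) R :=
      ⟨shiftWalk θ hvw x.walk ++ unshiftRest hvw hθ ht z, by
        rw [isWalkFrom_append, (isWalkFrom_shiftWalk hvw hθ ht R _).2]
        exact ⟨(isWalkFrom_shiftWalk hvw hθ ht R _).1.2 x.isWalk, hw.2⟩⟩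
    have hu := unshift_eq hvw hθ ht (y := y) (x := x) (unshiftRest_eq hvw hθ ht z) rfl
    have hy : unshiftVertex hvw hθ ht y ∈ S := by rwa [hu.1]
    refine ⟨y, hy, UnfoldingTree.ext ?_⟩
    rw [hf y hy, hu.1, hu.2, hxz, ← walk_eq_unshift]
  · intro y hy
    rw [hf y hy, walk_eq_unshift hvw hθ ht y, terminus_append, terminus_append,
      (isWalkFrom_shiftWalk hvw hθ ht R _).2, (isWalkFrom_shiftWalk hvw hθ ht R _).2,
      hφ.terminus_eq hy]
  · intro y hy z p hp
    have hle := unshiftVertex_mono hvw hθ ht (y := y) (z := z) ⟨p, hp⟩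
    have hz : unshiftVertex hvw hθ ht z ∈ S := hS.2 _ hy _ hle
    obtain ⟨r, hr⟩ := hle
    -- Cancelling the common code leaves: rest of `y`, then `p`, equals the code of `r`, then rest
    -- of `z`.
    rw [walk_eq_unshift hvw hθ ht y, walk_eq_unshift hvw hθ ht z, ← hr, shiftWalk_append,
      List.append_assoc, List.append_assoc] at hp
    rw [hf y hy, hf z hz, hφ.map_append hy.1 hr, shiftWalk_append, List.append_assoc,
      List.append_assoc, List.append_cancel_left hp]
  · refine ⟨hψ, S, hS, Set.sdiff_subset, fun x hx => ?_⟩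
    have hu := unshift_eq hvw hθ ht (y := shiftVertex hvw hθ ht x) (x := x) (Or.inl rfl)
      (List.append_nil _).symm
    have hx' : unshiftVertex hvw hθ ht (shiftVertex hvw hθ ht x) ∈ S := by rwa [hu.1]
    refine ⟨hsource ▸ hx', UnfoldingTree.ext ?_⟩
    rw [hfun, hf _ hx', hu.1, hu.2, List.append_nil]
    rfl

theorem exists_shiftRelated_left (hG : G.RowFinite) {ψ : AlmostAutRep (G.shift θ) R}
    (hψ : ψ.IsHigmanThompson) :
    ∃ φ : AlmostAutRep G R, φ.IsHigmanThompson ∧ ShiftRelated hvw hθ ht φ ψ := by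
  set T := ψ.source \ basis ψ.source
  have hT : IsCofiniteSubspace T := ψ.cofinite_diff_basis hG.shift
  have hex : ∀ x, ∃ z : UnfoldingTree G R, shiftVertex hvw hθ ht x ∈ T →
      shiftVertex hvw hθ ht z = ψ.toPartialEquiv (shiftVertex hvw hθ ht x) := by
    intro x
    by_cases hx : shiftVertex hvw hθ ht x ∈ T
    -- If the value ended in `none`, so would the image of `x`, as `ψ` keeps last edges on `T`.
    -- Hence the value lies in the image of the embedding.
    · obtain ⟨l, l', e, h, h'⟩ := hψ.exists_last_edge hx
      obtain ⟨z, hz⟩ := exists_shiftVertex_eq hvw hθ ht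
        (y := ψ.toPartialEquiv (shiftVertex hvw hθ ht x)) fun m hm => by
          rw [h'] at hm
          obtain rfl : e = none := by simpa using (List.append_inj' hm rfl).2
          exact shiftWalk_ne_concat_none hvw hθ _ _ h
      exact ⟨z, fun _ => hz⟩
    · exact ⟨x, fun h => (hx h).elim⟩
  choose f hf using hex
  refine Exists.imp (fun φ ⟨hφ, hsource, hfun⟩ => ?_)
    (AlmostAutRep.exists_isHigmanThompson
      (cofinite_preimage_shiftVertex hvw hθ ht hT) f ?_ ?_ ?_ ?_)
  · intro x hx y hy h
    have h' := congrArg (shiftVertex hvw hθ ht) h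
    rw [hf x hx, hf y hy] at h'
    exact shiftVertex_injective hvw hθ ht (ψ.toPartialEquiv.injOn hx.1 hy.1 h')
  · refine ((ψ.finite_compl_image_diff_basis hG.shift).preimage
      (shiftVertex_injective hvw hθ ht).injOn).subset fun z hz hmem => hz ?_
    obtain ⟨y, hy, hyz⟩ := hmem
    -- The same argument backwards: the value is an image, so `y` cannot end in `none`.
    obtain ⟨l, l', e, h, h'⟩ := hψ.exists_last_edge hy
    obtain ⟨x, rfl⟩ := exists_shiftVertex_eq hvw hθ ht (y := y) fun m hm => by
      rw [h] at hm
      obtain rfl : e = none := by simpa using (List.append_inj' hm rfl).2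
      rw [hyz] at h'
      exact shiftWalk_ne_concat_none hvw hθ _ _ h'
    exact ⟨x, hy, shiftVertex_injective hvw hθ ht ((hf x hy).trans hyz)⟩
  · intro x hx
    rw [← terminus_shiftVertex hvw hθ ht, hf x hx, hψ.terminus_eq hx, terminus_shiftVertex]
  · intro x hx y p hp
    have hxy : shiftVertex hvw hθ ht x ≤ shiftVertex hvw hθ ht y :=
      shiftVertex_mono hvw hθ ht ⟨p, hp⟩
    have hy : shiftVertex hvw hθ ht y ∈ T := hT.2 _ hx _ hxy
    have hp' : (shiftVertex hvw hθ ht x).walk ++ shiftWalk θ hvw p =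
        (shiftVertex hvw hθ ht y).walk := by
      change shiftWalk θ hvw x.walk ++ _ = shiftWalk θ hvw y.walk
      rw [← hp, shiftWalk_append]
    have h := hψ.map_append hx.1 hp'
    rw [← hf x hx, ← hf y hy] at h
    change shiftWalk θ hvw (f y).walk = shiftWalk θ hvw (f x).walk ++ shiftWalk θ hvw p at h
    rw [← shiftWalk_append] at h
    exact (shiftWalk_append_inj hvw hθ (Or.inl rfl) (Or.inl rfl)
      (congrArg (· ++ []) h)).1
  · refine ⟨hφ, _, cofinite_preimage_shiftVertex hvw hθ ht hT, hsource.ge, fun x hx => ?_⟩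
    exact ⟨hx.1, by rw [hfun, hf x hx]⟩

/-- Elements of the two Higman-Thompson groups with representatives that are intertwined by the
embedding of trees. -/
def HigmanThompsonRelated (g : G.higmanThompson R) (g' : (G.shift θ).higmanThompson R) : Prop :=
  ∃ (φ : AlmostAutRep G R) (ψ : AlmostAutRep (G.shift θ) R),
    φ.IsHigmanThompson ∧ ψ.IsHigmanThompson ∧
    g.1 = Quotient.mk _ φ ∧ g'.1 = Quotient.mk _ ψ ∧
    ShiftRelated hvw hθ ht φ ψ

include hvw hθ ht in
theorem nonempty_higmanThompson_mulEquiv_shift (hG : G.RowFinite) :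
    Nonempty (G.higmanThompson R ≃* (G.shift θ).higmanThompson R) := by
  have htotal : ∀ g : G.higmanThompson R, ∃ g', HigmanThompsonRelated hvw hθ ht g g' := by
    rintro ⟨_, φ, hφ, rfl⟩
    obtain ⟨ψ, hψ, h⟩ := exists_shiftRelated_right hvw hθ ht hG hφ
    exact ⟨⟨_, ψ, hψ, rfl⟩, φ, ψ, hφ, hψ, rfl, rfl, h⟩
  have hfunc : ∀ {g g₁ g₂}, HigmanThompsonRelated hvw hθ ht (R := R) g g₁ →
      HigmanThompsonRelated hvw hθ ht g g₂ → g₁ = g₂ := by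
    rintro g g₁ g₂ ⟨φ, ψ, -, hψ, hg, hg₁, h⟩ ⟨φ', ψ', -, hψ', hg', hg₂, h'⟩
    apply Subtype.ext
    rw [hg₁, hg₂]
    exact Quotient.sound
      (h.equivalent_right hvw hθ ht hψ hψ' (Quotient.exact (hg.symm.trans hg')) h')
  choose f hf using htotal
  let F : G.higmanThompson R →* (G.shift θ).higmanThompson R := MonoidHom.mk' f fun a b => by
    -- By uniqueness of the partner, it suffices that the product of the partners is related to `a *
    -- b`.
    refine hfunc (hf (a * b)) ?_
    obtain ⟨φ, ψ, hφ, hψ, ha, ha', h⟩ := hf a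
    obtain ⟨φ', ψ', hφ', hψ', hb, hb', h'⟩ := hf b
    refine ⟨φ.comp φ', ψ.comp ψ', hφ.comp hφ', hψ.comp hψ', ?_, ?_, h.comp hvw hθ ht h'⟩
    · rw [Subgroup.coe_mul, ha, hb]
      rfl
    · rw [Subgroup.coe_mul, ha', hb']
      rfl
  refine ⟨MulEquiv.ofBijective F ⟨fun a b hab => ?_, ?_⟩⟩
  · obtain ⟨φ, ψ, -, -, ha, ha', h⟩ := hf a
    obtain ⟨φ', ψ', -, -, hb, hb', h'⟩ := hf b
    have hab' : f a = f b := hab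
    apply Subtype.ext
    rw [ha, hb]
    have hψ := ha'.symm.trans ((congrArg Subtype.val hab').trans hb')
    exact Quotient.sound (h.equivalent_left hvw hθ ht (Quotient.exact hψ) h')
  · rintro ⟨_, ψ, hψ, rfl⟩
    obtain ⟨φ, hφ, h⟩ := exists_shiftRelated_left hvw hθ ht hG hψ
    exact ⟨⟨_, φ, hφ, rfl⟩, hfunc (hf _) ⟨φ, ψ, hφ, hψ, rfl, rfl, h⟩⟩

end Correspondence

end MultiDigraph

theorem corollary2 {V : Type*} {E : Type*} (G : MultiDigraph V E) (hG : G.RowFinite)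
    (R : V) (hR : G.IsRoot R) (v w : V) (hvw : v ≠ w)
    (θ : {e : E // G.o e = w} → {e : E // G.o e = v}) (hθ : Function.Injective θ)
    (ht : ∀ e : {e : E // G.o e = w}, G.t (θ e) = G.t e) :
    Nonempty (G.higmanThompson R ≃* (G.shift θ).higmanThompson R) := by
  exact MultiDigraph.nonempty_higmanThompson_mulEquiv_shift hvw hθ ht hG
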